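/- Let $p,m$ be integers with $1<m<p$ and $m\mid p$, let $b,a>0$ and put $s=b/a$. For a partition $\theta$ of $\{1,\dots,p\}$ into $m$ unlabelled groups of size $p/m$, the non-overlapping Gaussian latent factor (NGLF) model with structure $\theta$ has one latent factor $Z_B\sim N(0,b)$ for each group $B\in\theta$, and observed variables $X_i=Z_{B(i)}+\eta_i$ with noise $\eta_i\sim N(0,a)$, where $B(i)$ is the group containing $i$ and all $Z_B,\eta_i$ are independent; thus every factor has $p/m$ children, and parent and child are joined by an additive white Gaussian noise channel with signal-to-noise ratio $s$. Let $\hat\theta$ be any (possibly randomized) estimator of $\theta$ from $n$ i.i.d. samples of $X=(X_1,\dots,X_p)$ whose error probability $\Pr[\hat\theta\ne\theta]$, for $\theta$ uniformly distributed over all $\binom{p}{p/m,\dots,p/m}\frac1{m!}$ such partitions, is at most $\varepsilon$ (in particular this holds if its error probability is at most $\varepsilon$ for every $\theta$). Then, with logarithms to any fixed base $\beta\ge 2$ (for instance $2$ or $e$), $$(p-1)\log_\beta\Big(1+s\,\frac{1-1/m}{1-1/p}\Big)-(m-1)\log_\beta\Big(1+s\,\frac pm\Big)>0$$ and $$n\;\ge\;\frac{2\Big((1-\varepsilon)\log_\beta\Big(\binom{p}{p/m,\dots,p/m}\frac1{m!}\Big)-1\Big)}{(p-1)\log_\beta\Big(1+s\,\frac{1-1/m}{1-1/p}\Big)-(m-1)\log_\beta\Big(1+s\,\frac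 pm\Big)}.$$ -/

import Mathlib

open MeasureTheory ProbabilityTheory
open scoped NNReal

noncomputable section

/-- The structures to be recovered: partitions of the `p` observed variables into `m` groups
of `p / m` variables each.  A group is the set of children of one latent factor, so the latent
factors are regarded as unlabelled. -/
abbrev EqualPartition (p m : ℕ) : Type :=
  {P : Finpartition (Finset.univ : Finset (Fin p)) //
    P.parts.card = m ∧ ∀ B ∈ P.parts, B.card = p / m}

/-- The set of structures is finite; every subset of it is measurable. -/
instance EqualPartition.instMeasurableSpace (p m : ℕ) : MeasurableSpace (EqualPartition p m) := ⊤

namespace NGLF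

variable {p m : ℕ}

/-- The latent factors of a structure, one for each group of observed variables. -/
abbrev Factor (θ : EqualPartition p m) : Type := {B : Finset (Fin p) // B ∈ θ.1.parts}

/-- The unique parent of the observed variable `i`: the factor of the group containing `i`. -/
def parent (θ : EqualPartition p m) (i : Fin p) : Factor θ :=
  ⟨θ.1.part i, θ.1.part_mem.2 (Finset.mem_univ i)⟩

/-- The joint law of the latent variables `Z` and of the noise `η`: all coordinates are
independent centred Gaussians, of variance `b` for `Z` and of variance `a` for `η`. -/
def sourceLaw (θ : EqualPartition p m) (b a : ℝ≥0) :
    Measure ((Factor θ → ℝ) × (Fin p → ℝ)) :=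
  (Measure.pi fun _ : Factor θ => gaussianReal 0 b).prod
    (Measure.pi fun _ : Fin p => gaussianReal 0 a)

/-- The additive white Gaussian noise channels from parents to children:
`X i = Z (parent i) + η i`. -/
def observe (θ : EqualPartition p m) (ω : (Factor θ → ℝ) × (Fin p → ℝ)) : Fin p → ℝ :=
  fun i => ω.1 (parent θ i) + ω.2 i

/-- The law of the observed vector `X` in the model with structure `θ`, latent variance `b`
and noise variance `a`. -/
def observedLaw (θ : EqualPartition p m) (b a : ℝ≥0) : Measure (Fin p → ℝ) :=
  (sourceLaw θ b a).map (observe θ)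

/-- The law of `n` independent samples of the observed vector. -/
def sampleLaw (n : ℕ) (θ : EqualPartition p m) (b a : ℝ≥0) : Measure (Fin n → Fin p → ℝ) :=
  Measure.pi fun _ : Fin n => observedLaw θ b a

/-- The probability that the (possibly randomized) estimator `K`, applied to `n` independent
samples from the model with structure `θ`, returns something else than `θ`. -/
def errorProb {n : ℕ} (K : Kernel (Fin n → Fin p → ℝ) (EqualPartition p m))
    (b a : ℝ≥0) (θ : EqualPartition p m) : ℝ :=
  ((sampleLaw n θ b a).bind K).real {θ}ᶜ

/-- The error probability of `K` when the structure is drawn uniformly at random. -/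
def avgErrorProb {n : ℕ} (K : Kernel (Fin n → Fin p → ℝ) (EqualPartition p m))
    (b a : ℝ≥0) : ℝ :=
  (∑ θ : EqualPartition p m, errorProb K b a θ) / (Fintype.card (EqualPartition p m) : ℝ)

/-- The number of ways to divide `p` variables into `m` unlabelled groups of equal size:
a multinomial coefficient divided by `m!`. -/
def numStructures (p m : ℕ) : ℝ :=
  (Nat.multinomial (Finset.univ : Finset (Fin m)) (fun _ => p / m) : ℝ) / (Nat.factorial m : ℝ)

end NGLF

end

noncomputable section

/-! This is Fano's method with a well-chosen reference law. The observed vector under θ is centred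
Gaussian with covariance Σ_θ = a I + b M Mᵀ, where M is the incidence matrix. For the reference take
the centred Gaussian whose covariance T is the average of the Σ_θ over all structures; by symmetry T
is an equicorrelation matrix. Fano's inequality (`fano_of_withDensity`) then bounds the average
success probability times log N by n · KL(P_θ ‖ ν) + log 2, where N is the number of structures.

The divergence does not depend on θ (`NGLF.integral_logRatio_observedLaw`). T⁻¹ is a combination of
I and the all-ones matrix, and T and Σ_θ share their trace and their sum of entries, so tr(T⁻¹ Σ_θ)
= p and only (log det T − log det Σ_θ) / 2 remains. The eigenvalue a(1 + s p/m) has multiplicity m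
in Σ_θ and 1 in T, hence the factor m − 1. The other eigenvalue of T, of multiplicity p − 1, gives
the positive term.

The denominator is positive by strict concavity of log (`log_weighted_lt`). Of the count of
structures only a lower bound on N is needed (`NGLF.numStructures_le_card`). -/

/-! ### Fano's inequality against a reference measure -/

lemma exp_mul_log_le {c t : ℝ} (hc : 0 < c) (ht0 : 0 ≤ t) (ht1 : t ≤ 1) :
    Real.exp (t * Real.log c) ≤ 1 + (c - 1) * t := by
  have h := convexOn_exp.2 (Set.mem_univ 0) (Set.mem_univ (Real.log c))
    (sub_nonneg.2 ht1) ht0 (by ring)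
  simp only [smul_eq_mul, mul_zero, zero_add, Real.exp_zero, mul_one, Real.exp_log hc] at h
  linarith

/-- Fano's inequality in variational form. -/
theorem fano_of_withDensity {Ω Θ : Type*} [MeasurableSpace Ω] [Fintype Θ] [Nonempty Θ]
    [MeasurableSpace Θ] [MeasurableSingletonClass Θ]
    (ν : Measure Ω) [IsProbabilityMeasure ν] (P : Θ → Measure Ω)
    [∀ θ, IsProbabilityMeasure (P θ)] (l : Θ → Ω → ℝ) (hl : ∀ θ, Measurable (l θ))
    (hP : ∀ θ, P θ = ν.withDensity fun x => ENNReal.ofReal (Real.exp (l θ x)))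
    (K : Kernel Ω Θ) [IsMarkovKernel K] (κ : ℝ)
    (hint : ∀ θ, Integrable (l θ) (P θ)) (hκ : ∀ θ, ∫ x, l θ x ∂(P θ) ≤ κ) :
    (∑ θ, ((P θ).bind K).real {θ}) * Real.log (Fintype.card Θ) ≤
      Fintype.card Θ * (κ + Real.log 2) := by
  set N : ℝ := (Fintype.card Θ : ℝ) with hN
  have hN1 : 1 ≤ N := by
    rw [hN]; exact_mod_cast (Fintype.card_pos : 0 < Fintype.card Θ)
  set k : Θ → Ω → ℝ := fun θ x => (K x).real {θ} with hk
  have hkm (θ) : Measurable (k θ) :=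
    (Kernel.measurable_coe K (measurableSet_singleton θ)).ennreal_toReal
  have hk0 (θ x) : 0 ≤ k θ x := measureReal_nonneg
  have hk1 (θ x) : k θ x ≤ 1 := measureReal_le_one
  have hki (θ) (μ : Measure Ω) [IsProbabilityMeasure μ] : Integrable (k θ) μ :=
    Integrable.of_bound (hkm θ).aestronglyMeasurable 1
      (.of_forall fun x => by simpa [abs_of_nonneg (hk0 θ x)] using hk1 θ x)
  have hksum (x) : ∑ θ, k θ x = 1 := by
    have := measureReal_biUnion_finset (μ := K x) (s := Finset.univ) (f := fun θ : Θ => {θ})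
      (fun i _ j _ h => by simpa using h) (fun θ _ => measurableSet_singleton θ)
    rw [hk]
    simp only
    rw [← this]
    simp [Set.iUnion_of_singleton]
  have hbind (θ) : ((P θ).bind K).real {θ} = ∫ x, k θ x ∂(P θ) := by
    rw [Measure.real, Measure.bind_apply (measurableSet_singleton θ) K.measurable.aemeasurable,
      ← integral_toReal (Kernel.measurable_coe K (measurableSet_singleton θ)).aemeasurable]
    · rfl
    · exact .of_forall fun x => measure_lt_top _ _
  -- The chord 1 + (N − 1)k lies above N^k for k in [0, 1]. Being affine in k, it can be summed over
  -- θ using only that the k θ x add up to 1.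
  set h : Θ → Ω → ℝ := fun θ x => 1 + (N - 1) * k θ x with hh
  have hhi (θ) : Integrable (h θ) ν := (integrable_const _).add ((hki θ ν).const_mul _)
  have hhR (θ) : ∫ x, h θ x ∂ν = 1 + (N - 1) * ∫ x, k θ x ∂ν := by
    rw [hh]
    simp only
    rw [integral_add (integrable_const _) ((hki θ ν).const_mul _), integral_const_mul]
    simp
  have hmeas (θ) : Measurable fun x => ENNReal.ofReal (Real.exp (l θ x)) := by
    have := hl θ
    fun_prop
  have hmul (θ) (x) : (ENNReal.ofReal (Real.exp (l θ x))).toReal • (h θ x * Real.exp (-l θ x))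
      = h θ x := by
    rw [ENNReal.toReal_ofReal (Real.exp_pos _).le, smul_eq_mul, mul_comm, mul_assoc,
      ← Real.exp_add]
    simp
  have hPi (θ) : Integrable (fun x => h θ x * Real.exp (-l θ x)) (P θ) := by
    rw [hP θ, integrable_withDensity_iff_integrable_smul' (hmeas θ)
      (.of_forall fun x => ENNReal.ofReal_lt_top)]
    simp_rw [hmul θ]
    exact hhi θ
  have hPh (θ) : ∫ x, h θ x * Real.exp (-l θ x) ∂(P θ) = ∫ x, h θ x ∂ν := by
    rw [hP θ, integral_withDensity_eq_integral_toReal_smul (hmeas θ)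
      (.of_forall fun x => ENNReal.ofReal_lt_top)]
    simp_rw [hmul θ]
  -- This is u + 1 ≤ exp u at u = k log N − l − log 2. Since exp(−l) turns P θ back into ν, the
  -- right side integrates to a ν-integral. The shift by log 2 is chosen because the h θ will sum to
  -- 2N − 1, about 2 per structure.
  have hpt (θ) (x) : k θ x * Real.log N - l θ x ≤
      (Real.log 2 - 1) + (1 / 2) * (h θ x * Real.exp (-l θ x)) := by
    have h1 : Real.exp (k θ x * Real.log N) ≤ h θ x :=
      exp_mul_log_le (by linarith) (hk0 θ x) (hk1 θ x)
    have h2 := Real.add_one_le_exp (k θ x * Real.log N - l θ x - Real.log 2)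
    rw [Real.exp_sub, Real.exp_log two_pos, Real.exp_sub, ← mul_one_div,
      div_eq_mul_inv, ← Real.exp_neg] at h2
    have h3 := mul_le_mul_of_nonneg_right h1 (Real.exp_pos (-l θ x)).le
    linarith
  have hθ (θ) : ((P θ).bind K).real {θ} * Real.log N ≤
      κ + (Real.log 2 - 1) + (1 / 2) * (1 + (N - 1) * ∫ x, k θ x ∂ν) := by
    have := integral_mono (((hki θ (P θ)).mul_const (Real.log N)).sub (hint θ))
      ((integrable_const (Real.log 2 - 1)).add ((hPi θ).const_mul (1 / 2))) (hpt θ)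
    simp only [Pi.sub_apply, Pi.add_apply] at this
    rw [integral_sub ((hki θ (P θ)).mul_const (Real.log N)) (hint θ), integral_mul_const,
      integral_add (integrable_const _) ((hPi θ).const_mul _), integral_const_mul, hPh, hhR] at this
    rw [hbind]
    have := hκ θ
    simp at *
    linarith
  have hRsum : ∑ θ, ∫ x, k θ x ∂ν = 1 := by
    rw [← integral_finsetSum _ fun θ _ => hki θ ν]
    simp [hksum]
  calc _ = ∑ θ, ((P θ).bind K).real {θ} * Real.log N := by rw [Finset.sum_mul]
    _ ≤ ∑ θ, (κ + (Real.log 2 - 1) + (1 / 2) * (1 + (N - 1) * ∫ x, k θ x ∂ν)) :=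
      Finset.sum_le_sum fun θ _ => hθ θ
    _ = N * (κ + (Real.log 2 - 1)) + (1 / 2) * (N + (N - 1)) := by
      simp only [Finset.sum_add_distrib, ← Finset.mul_sum, hRsum]
      simp [← hN]
      ring
    _ ≤ _ := by linarith

/-! ### Densities of product measures -/

theorem MeasureTheory.lintegral_fin_nat_prod_eq_prod {n : ℕ} {E : Fin n → Type*}
    {mE : ∀ i, MeasurableSpace (E i)} {μ : (i : Fin n) → Measure (E i)} [∀ i, SigmaFinite (μ i)]
    (f : (i : Fin n) → E i → ENNReal) (hf : ∀ i, Measurable (f i)) :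
    ∫⁻ x : (i : Fin n) → E i, ∏ i, f i (x i) ∂(Measure.pi μ) = ∏ i, ∫⁻ x, f i x ∂(μ i) := by
  induction n with
  | zero => simp
  | succ n n_ih =>
      calc
        _ = ∫⁻ x : E 0 × ((i : Fin n) → E (Fin.succ i)),
            f 0 x.1 * ∏ i : Fin n, f (Fin.succ i) (x.2 i)
            ∂((μ 0).prod (Measure.pi (fun i ↦ μ i.succ))) := by
          rw [← (measurePreserving_piFinSuccAbove μ 0).symm.map_eq, lintegral_map_equiv]
          exact lintegral_congr fun x => Fin.prod_univ_succ _
        _ = (∫⁻ x, f 0 x ∂μ 0)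
            * ∏ i : Fin n, ∫⁻ (x : E (Fin.succ i)), f (Fin.succ i) x ∂(μ i.succ) := by
          rw [← n_ih _ fun i => hf i.succ]
          exact lintegral_prod_mul (hf 0).aemeasurable
            (Finset.measurable_prod _ fun (i : Fin n) _ =>
              (hf i.succ).comp (measurable_pi_apply i)).aemeasurable
        _ = ∏ i, ∫⁻ x, f i x ∂(μ i) := by rw [Fin.prod_univ_succ]

theorem MeasureTheory.Measure.pi_withDensity {n : ℕ} {X : Fin n → Type*}
    [∀ i, MeasurableSpace (X i)] (μ : ∀ i, Measure (X i)) [∀ i, SigmaFinite (μ i)]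
    (f : ∀ i, X i → ENNReal) (hf : ∀ i, Measurable (f i))
    [∀ i, SigmaFinite ((μ i).withDensity (f i))] :
    Measure.pi (fun i => (μ i).withDensity (f i)) =
      (Measure.pi μ).withDensity fun x => ∏ i, f i (x i) := by
  refine (Measure.pi_eq fun s hs => ?_)
  rw [withDensity_apply _ (.univ_pi hs), ← lintegral_indicator (.univ_pi hs)]
  have : ∀ x : (∀ i, X i), (Set.univ.pi s).indicator (fun x => ∏ i, f i (x i)) x =
      ∏ i, (s i).indicator (f i) (x i) := by
    intro x
    classical
    by_cases hx : x ∈ Set.univ.pi s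
    · rw [Set.indicator_of_mem hx]
      exact Finset.prod_congr rfl fun i _ => (Set.indicator_of_mem (hx i trivial) _).symm
    · rw [Set.indicator_of_notMem hx]
      simp only [Set.mem_pi, Set.mem_univ, true_imp_iff, not_forall] at hx
      obtain ⟨i, hi⟩ := hx
      exact (Finset.prod_eq_zero (Finset.mem_univ i) (Set.indicator_of_notMem hi _)).symm
  simp_rw [this]
  rw [lintegral_fin_nat_prod_eq_prod _ fun i => (hf i).indicator (hs i)]
  exact Finset.prod_congr rfl fun i _ => by
    rw [lintegral_indicator (hs i), withDensity_apply _ (hs i)]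

/-! ### Positivity of the denominator -/

lemma log_weighted_lt {p m s : ℝ} (hm : 1 < m) (hmp : m < p) (hs : 0 < s) :
    (m - 1) * Real.log (1 + s * (p / m)) <
      (p - 1) * Real.log (1 + s * ((1 - 1 / m) / (1 - 1 / p))) := by
  have hp1 : 0 < p - 1 := by linarith
  have hr : 0 < s * (p / m) := mul_pos hs (div_pos (by linarith) (by linarith))
  -- The argument on the right of the claim is the mean of 1 + s p/m and 1 with weights (m − 1)/(p −
  -- 1) and (p − m)/(p − 1); the point 1 contributes log 1 = 0.
  have h := strictConcaveOn_log_Ioi.2 (Set.mem_Ioi.2 (by positivity : 0 < 1 + s * (p / m)))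
    (Set.mem_Ioi.2 one_pos) (by linarith) (div_pos (by linarith : 0 < m - 1) hp1)
    (div_pos (by linarith : 0 < p - m) hp1) (by field_simp; ring)
  simp only [smul_eq_mul, Real.log_one, mul_zero, add_zero] at h
  have e : (m - 1) / (p - 1) * (1 + s * (p / m)) + (p - m) / (p - 1) * 1 =
      1 + s * ((1 - 1 / m) / (1 - 1 / p)) := by
    have : p ≠ 0 := by linarith
    have : 1 - 1 / p ≠ 0 := by
      rw [one_sub_div ‹p ≠ 0›]
      exact (div_pos hp1 (by linarith)).ne'
    field_simp
    ring
  rw [e, div_mul_eq_mul_div, div_lt_iff₀ hp1] at h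
  linarith

/-! ### Counting the structures -/

open Finset in
lemma Equiv.Perm.card_filter_comp_eq_le {α β : Type*} [Fintype α] [DecidableEq α] [Fintype β]
    [DecidableEq β] (f g : α → β) :
    #{σ : Equiv.Perm α | f ∘ σ = g} ≤ ∏ b, (#{a | f a = b}).factorial := by
  rcases ({σ : Equiv.Perm α | f ∘ σ = g} : Finset (Equiv.Perm α)).eq_empty_or_nonempty with
    h | ⟨σ₀, h₀⟩
  · simp [h]
  · simp only [mem_filter, mem_univ, true_and] at h₀
    have := DomMulAct.stabilizer_card f
    simp only [Fintype.card_subtype] at this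
    rw [← this]
    -- Right multiplication by σ₀⁻¹ embeds the solutions of f ∘ σ = g into the stabilizer of f.
    refine card_le_card_of_injOn (fun σ => σ * σ₀⁻¹) (fun σ hσ => ?_)
      (fun _ _ _ _ h => mul_right_cancel h)
    simp only [coe_filter, mem_univ, true_and, Set.mem_ofPred_eq] at hσ ⊢
    funext x
    have := congrFun (hσ.trans h₀.symm) (σ₀⁻¹ x)
    simpa using this

instance Setoid.decidableRelKer {α β : Type*} [DecidableEq β] (f : α → β) :
    DecidableRel (Setoid.ker f) :=
  fun a b => inferInstanceAs (Decidable (f a = f b))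

open Finset in
/-- The partition into fibers of a function with `m` values, each taken `p / m` times. -/
def EqualPartition.ofFun {p m : ℕ} (hk : p / m ≠ 0) (f : Fin p → Fin m)
    (hf : ∀ j, #{i | f i = j} = p / m) : EqualPartition p m :=
  ⟨Finpartition.ofSetoid (Setoid.ker f), by
    have hparts : (Finpartition.ofSetoid (Setoid.ker f)).parts =
        univ.image fun j => ({i | f i = j} : Finset (Fin p)) := by
      ext B
      simp only [Finpartition.ofSetoid, Finpartition.ofSetSetoid, mem_image, mem_univ, true_and]
      constructor
      · rintro ⟨a, rfl⟩
        exact ⟨f a, by ext; simp [Setoid.ker_def, eq_comm]⟩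
      · rintro ⟨j, rfl⟩
        obtain ⟨a, ha⟩ : ({i | f i = j} : Finset (Fin p)).Nonempty := by
          rw [← card_pos, hf]; exact Nat.pos_of_ne_zero hk
        simp only [mem_filter, mem_univ, true_and] at ha
        exact ⟨a, by ext; simp [Setoid.ker_def, eq_comm, ha]⟩
    rw [hparts]
    constructor
    · rw [card_image_of_injective]
      · simp
      · intro j j' h
        obtain ⟨a, ha⟩ : ({i | f i = j} : Finset (Fin p)).Nonempty := by
          rw [← card_pos, hf]; exact Nat.pos_of_ne_zero hk
        have ha' := ha
        simp only at h
        rw [h] at ha'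
        simp only [mem_filter, mem_univ, true_and] at ha ha'
        exact ha.symm.trans ha'
    · simp only [mem_image, mem_univ, true_and]
      rintro _ ⟨j, rfl⟩
      exact hf j⟩

lemma EqualPartition.ofFun_eq_iff {p m : ℕ} (hk : p / m ≠ 0) {f g : Fin p → Fin m} {hf hg}
    (h : ofFun hk f hf = ofFun hk g hg) (x y : Fin p) : f x = f y ↔ g x = g y := by
  have h' : Finpartition.ofSetoid (Setoid.ker f) = Finpartition.ofSetoid (Setoid.ker g) :=
    congrArg Subtype.val h
  have := Finpartition.mem_part_ofSetoid_iff_rel (s := Setoid.ker f) (a := x) (b := y)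
  have h2 := Finpartition.mem_part_ofSetoid_iff_rel (s := Setoid.ker g) (a := x) (b := y)
  simp only [h', Setoid.ker_def] at this h2
  exact this.symm.trans h2

lemma exists_perm_comp_eq {α β : Type*} [Finite β] {f g : α → β} (hf : Function.Surjective f)
    (h : ∀ x y, f x = f y ↔ g x = g y) : ∃ π : Equiv.Perm β, π ∘ f = g := by
  obtain ⟨r, hr⟩ := hf.hasRightInverse
  have hinj : Function.Injective (g ∘ r) := fun i j hij => by
    have := (h _ _).2 hij
    rwa [hr, hr] at this
  refine ⟨Equiv.ofBijective _ (Finite.injective_iff_bijective.1 hinj), ?_⟩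
  funext x
  exact (h _ _).1 (hr (f x))

-- Two maps with bounded fibers: a permutation σ goes to the balanced labelling f₀ ∘ σ, with at most
-- (p/m)!^m preimages for each labelling, and a balanced labelling goes to its partition into
-- fibers, with at most m! preimages since two labellings with the same fibers differ by a
-- permutation of labels.
open Finset in
lemma factorial_le_card_equalPartition {p m : ℕ} (hm : m ≠ 0) (hp : p ≠ 0) (hdvd : m ∣ p) :
    p.factorial ≤
      (p / m).factorial ^ m * (m.factorial * Fintype.card (EqualPartition p m)) := by
  classical
  obtain ⟨k, rfl⟩ := hdvd
  have hk : k ≠ 0 := by rintro rfl; simp at hp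
  have hdiv : m * k / m = k := Nat.mul_div_cancel_left _ (Nat.pos_of_ne_zero hm)
  set F : Finset (Fin (m * k) → Fin m) := {f | ∀ j, #{i | f i = j} = m * k / m} with hF
  let f₀ : Fin (m * k) → Fin m := fun i => (finProdFinEquiv.symm i).1
  have hf₀ : ∀ j, #{i | f₀ i = j} = m * k / m := by
    intro j
    rw [hdiv, ← Fintype.card_subtype, Fintype.card_congr (finProdFinEquiv.symm.subtypeEquiv
      (q := fun x => x.1 = j) fun _ => Iff.rfl), Fintype.card_subtype]
    have : ({x : Fin m × Fin k | x.1 = j} : Finset _) = {j} ×ˢ univ := by ext ⟨_, _⟩; simp [eq_comm]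
    rw [this, card_product]
    simp
  have h1 : #(univ : Finset (Equiv.Perm (Fin (m * k)))) ≤ (m * k / m).factorial ^ m * #F := by
    refine card_le_mul_card_image_of_maps_to (f := fun σ : Equiv.Perm _ => f₀ ∘ σ)
      (fun σ _ => ?_) _ fun g _ => ?_
    · simp only [hF, mem_filter, mem_univ, true_and]
      intro j
      rw [← hf₀ j]
      exact card_bij (fun i _ => σ i) (by simp) (by simp)
        fun b hb => ⟨σ.symm b, by simpa using hb, by simp⟩
    · refine (Equiv.Perm.card_filter_comp_eq_le f₀ g).trans_eq ?_
      simp [hf₀]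
  have h2 : #F.attach ≤ m.factorial * #(univ : Finset (EqualPartition (m * k) m)) := by
    refine card_le_mul_card_image_of_maps_to
      (f := fun f : F => EqualPartition.ofFun (hdiv.symm ▸ hk) f.1 (mem_filter.1 f.2).2)
      (fun _ _ => mem_univ _) _ fun P _ => ?_
    rcases (F.attach.filter fun f : F => EqualPartition.ofFun (hdiv.symm ▸ hk) f.1
      (mem_filter.1 f.2).2 = P).eq_empty_or_nonempty with h | ⟨f, hf⟩
    · simp [h]
    · have hperm : #(univ : Finset (Equiv.Perm (Fin m))) = m.factorial := by
        rw [card_univ, Fintype.card_perm, Fintype.card_fin]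
      rw [← card_map (Function.Embedding.subtype _), ← hperm]
      refine (card_le_card (t := univ.image fun π : Equiv.Perm (Fin m) => ⇑π ∘ f.1) ?_).trans
        card_image_le
      intro g hg
      simp only [mem_map, mem_filter, mem_attach, true_and] at hg hf
      obtain ⟨g, hg, rfl⟩ := hg
      have hsurj : Function.Surjective f.1 := fun j => by
        obtain ⟨a, ha⟩ : ({i | f.1 i = j} : Finset _).Nonempty := by
          rw [← card_pos, (mem_filter.1 f.2).2, hdiv]; omega
        exact ⟨a, by simpa using ha⟩
      obtain ⟨π, hπ⟩ := exists_perm_comp_eq hsurj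
        (EqualPartition.ofFun_eq_iff _ (hf.trans hg.symm))
      exact mem_image.2 ⟨π, mem_univ _, hπ⟩
  rw [card_attach] at h2
  rw [card_univ, Fintype.card_perm, Fintype.card_fin] at h1
  exact h1.trans (Nat.mul_le_mul_left _ h2)

lemma NGLF.numStructures_eq {p m : ℕ} (hdvd : m ∣ p) :
    numStructures p m = p.factorial / ((p / m).factorial ^ m * m.factorial) := by
  have h := Nat.multinomial_spec (Finset.univ : Finset (Fin m)) (fun _ => p / m)
  simp only [Finset.prod_const, Finset.card_univ, Fintype.card_fin, Finset.sum_const,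
    smul_eq_mul, Nat.mul_div_cancel' hdvd] at h
  rw [numStructures, ← h]
  have : ((p / m).factorial : ℝ) ≠ 0 := by exact_mod_cast Nat.factorial_ne_zero _
  push_cast
  field_simp

lemma NGLF.one_le_numStructures {p m : ℕ} (hm : m ≠ 0) (hp : p ≠ 0) (hdvd : m ∣ p) :
    1 ≤ numStructures p m := by
  rw [numStructures_eq hdvd, one_le_div (by positivity)]
  obtain ⟨k, rfl⟩ := hdvd
  have hk : k ≠ 0 := by rintro rfl; simp at hp
  rw [Nat.mul_div_cancel_left _ (Nat.pos_of_ne_zero hm)]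
  have h := Nat.uniformBell_mul_eq m hk
  have : k.factorial ^ m * m.factorial ∣ (m * k).factorial := ⟨_, by rw [← h]; ring⟩
  exact_mod_cast Nat.le_of_dvd (Nat.factorial_pos _) this

lemma NGLF.numStructures_le_card {p m : ℕ} (hm : m ≠ 0) (hp : p ≠ 0) (hdvd : m ∣ p) :
    numStructures p m ≤ Fintype.card (EqualPartition p m) := by
  rw [numStructures_eq hdvd, div_le_iff₀ (by positivity)]
  have := factorial_le_card_equalPartition hm hp hdvd
  calc (p.factorial : ℝ) ≤ _ := Nat.cast_le.2 this
    _ = _ := by push_cast; ring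

/-! ### Centred Gaussian measures: moments, densities, divergence -/

open Matrix

lemma Matrix.PosDef.exists_mul_transpose {p : ℕ} {S : Matrix (Fin p) (Fin p) ℝ} (hS : S.PosDef) :
    ∃ A : Matrix (Fin p) (Fin p) ℝ, A.det ≠ 0 ∧ S = A * Aᵀ := by
  open scoped MatrixOrder in
  obtain ⟨B, hB⟩ := CStarAlgebra.nonneg_iff_eq_star_mul_self.mp hS.posSemidef.nonneg
  have hB' : S = Bᵀ * Bᵀᵀ := by simpa [star_eq_conjTranspose, conjTranspose] using hB
  refine ⟨Bᵀ, fun h => ?_, hB'⟩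
  have := hS.det_pos
  rw [hB', det_mul, h, zero_mul] at this
  exact lt_irrefl _ this

/-- A measure with the characteristic function of the centred Gaussian law of covariance `S`. -/
def IsCenteredGaussian {p : ℕ} (μ : Measure (Fin p → ℝ)) (S : Matrix (Fin p) (Fin p) ℝ) : Prop :=
  ∀ w : Fin p → ℝ, ∫ x, Complex.exp ((w ⬝ᵥ x : ℝ) * Complex.I) ∂μ =
    Complex.exp (-((w ⬝ᵥ S *ᵥ w : ℝ) : ℂ) / 2)

lemma integral_exp_dotProduct_pi_gaussianReal {ι : Type*} [Fintype ι] (v : ℝ≥0) (w : ι → ℝ) :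
    ∫ x, Complex.exp ((w ⬝ᵥ x : ℝ) * Complex.I) ∂(Measure.pi fun _ : ι => gaussianReal 0 v) =
      Complex.exp (-((v * (w ⬝ᵥ w) : ℝ) : ℂ) / 2) := by
  simp_rw [dotProduct, Complex.ofReal_sum, Finset.sum_mul, Complex.exp_sum]
  rw [integral_fintype_prod_eq_prod
    (f := fun i x => Complex.exp (((w i * x : ℝ) : ℂ) * Complex.I))]
  simp_rw [Complex.ofReal_mul, ← charFun_apply_real, charFun_gaussianReal, ← Complex.exp_sum]
  congr 1
  simp only [Complex.ofReal_zero, mul_zero, zero_mul, zero_sub]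
  rw [Finset.sum_neg_distrib, ← Finset.sum_div, neg_div, Complex.ofReal_sum, Finset.mul_sum]
  congr 2
  exact Finset.sum_congr rfl fun i _ => by push_cast; ring

lemma IsCenteredGaussian.unique {p : ℕ} {μ ν : Measure (Fin p → ℝ)} [IsFiniteMeasure μ]
    [IsFiniteMeasure ν] {S : Matrix (Fin p) (Fin p) ℝ} (hμ : IsCenteredGaussian μ S)
    (hν : IsCenteredGaussian ν S) : μ = ν := by
  refine Measure.ext_of_charFunDual (funext fun L => ?_)
  obtain ⟨w, hL⟩ : ∃ w : Fin p → ℝ, ∀ x, L x = w ⬝ᵥ x := by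
    refine ⟨fun i => L (Pi.single i 1), fun x => ?_⟩
    conv_lhs => rw [pi_eq_sum_univ' x, map_sum]
    simp only [map_smul, smul_eq_mul, dotProduct]
    exact Finset.sum_congr rfl fun i _ => by rw [mul_comm]
  simp_rw [charFunDual_apply, hL]
  exact (hμ _).trans (hν _).symm

lemma IsCenteredGaussian.map_mulVec {p : ℕ} (A : Matrix (Fin p) (Fin p) ℝ) :
    IsCenteredGaussian ((Measure.pi fun _ : Fin p => gaussianReal 0 1).map (A *ᵥ ·)) (A * Aᵀ) := by
  intro w
  rw [integral_map (by fun_prop) (by fun_prop)]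
  have h (x : Fin p → ℝ) : w ⬝ᵥ A *ᵥ x = (Aᵀ *ᵥ w) ⬝ᵥ x := by
    rw [dotProduct_mulVec, mulVec_transpose]
  simp_rw [h]
  rw [integral_exp_dotProduct_pi_gaussianReal, ← mulVec_mulVec, h]
  simp

lemma IsCenteredGaussian.map_dotProduct {p : ℕ} {μ : Measure (Fin p → ℝ)} [IsFiniteMeasure μ]
    {S : Matrix (Fin p) (Fin p) ℝ} (hμ : IsCenteredGaussian μ S) (w : Fin p → ℝ)
    (hw : 0 ≤ w ⬝ᵥ S *ᵥ w) :
    μ.map (w ⬝ᵥ ·) = gaussianReal 0 (w ⬝ᵥ S *ᵥ w).toNNReal := by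
  have hm : Measurable (w ⬝ᵥ · : (Fin p → ℝ) → ℝ) := by
    simp only [dotProduct]; fun_prop
  refine Measure.ext_of_charFun (funext fun t => ?_)
  rw [charFun_apply_real, integral_map hm.aemeasurable (by fun_prop), charFun_gaussianReal]
  have h := hμ (t • w)
  simp only [smul_dotProduct, mulVec_smul, dotProduct_smul, smul_eq_mul, Complex.ofReal_mul] at h
  rw [h]
  congr 1
  simp only [Complex.ofReal_zero, mul_zero, zero_mul, zero_sub, Real.coe_toNNReal _ hw]
  ring

lemma IsCenteredGaussian.integrable_sq {p : ℕ} {μ : Measure (Fin p → ℝ)} [IsFiniteMeasure μ]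
    {S : Matrix (Fin p) (Fin p) ℝ} (hμ : IsCenteredGaussian μ S) (hS : S.PosSemidef)
    (w : Fin p → ℝ) :
    Integrable (fun x => (w ⬝ᵥ x) ^ 2) μ ∧ ∫ x, (w ⬝ᵥ x) ^ 2 ∂μ = w ⬝ᵥ S *ᵥ w := by
  have hm : Measurable (w ⬝ᵥ · : (Fin p → ℝ) → ℝ) := by
    simp only [dotProduct]; fun_prop
  have hw : 0 ≤ w ⬝ᵥ S *ᵥ w := by simpa using hS.dotProduct_mulVec_nonneg w
  have h := hμ.map_dotProduct w hw
  have hi : Integrable (fun y : ℝ => y ^ 2) (gaussianReal 0 (w ⬝ᵥ S *ᵥ w).toNNReal) :=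
    (memLp_id_gaussianReal 2).integrable_sq
  constructor
  · rw [← h] at hi
    exact hi.comp_measurable hm
  · have h2 : ∫ y, y ^ 2 ∂(gaussianReal 0 (w ⬝ᵥ S *ᵥ w).toNNReal) = w ⬝ᵥ S *ᵥ w := by
      have := variance_of_integral_eq_zero (μ := gaussianReal 0 (w ⬝ᵥ S *ᵥ w).toNNReal)
        (X := fun y => y) (by fun_prop) integral_id_gaussianReal
      rw [← this, variance_fun_id_gaussianReal, Real.coe_toNNReal _ hw]
    rw [← h, integral_map hm.aemeasurable (by fun_prop)] at h2
    exact h2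

lemma IsCenteredGaussian.integral_mul {p : ℕ} {μ : Measure (Fin p → ℝ)} [IsFiniteMeasure μ]
    {S : Matrix (Fin p) (Fin p) ℝ} (hμ : IsCenteredGaussian μ S) (hS : S.PosSemidef)
    (i j : Fin p) :
    Integrable (fun x => x i * x j) μ ∧ ∫ x, x i * x j ∂μ = S i j := by
  have hsymm : S j i = S i j := by simpa using hS.1.apply i j
  obtain ⟨h1, h1'⟩ := hμ.integrable_sq hS (Pi.single i 1 + Pi.single j 1)
  obtain ⟨h2, h2'⟩ := hμ.integrable_sq hS (Pi.single i 1)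
  obtain ⟨h3, h3'⟩ := hμ.integrable_sq hS (Pi.single j 1)
  -- Polarization reduces mixed moments to variances of one-dimensional marginals.
  have he : (fun x : Fin p → ℝ => x i * x j) = fun x =>
      (((Pi.single i 1 + Pi.single j 1 : Fin p → ℝ) ⬝ᵥ x) ^ 2
        - ((Pi.single i 1 : Fin p → ℝ) ⬝ᵥ x) ^ 2
        - ((Pi.single j 1 : Fin p → ℝ) ⬝ᵥ x) ^ 2) / 2 := by
    funext x
    simp only [add_dotProduct, single_dotProduct]
    ring
  rw [he]
  refine ⟨((h1.sub h2).sub h3).div_const 2, ?_⟩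
  have h12 : Integrable (fun x => ((Pi.single i 1 + Pi.single j 1 : Fin p → ℝ) ⬝ᵥ x) ^ 2
      - ((Pi.single i 1 : Fin p → ℝ) ⬝ᵥ x) ^ 2) μ := h1.sub h2
  rw [integral_div, integral_sub h12 h3, integral_sub h1 h2, h1', h2', h3']
  simp [add_dotProduct, single_dotProduct, mulVec_add, hsymm]
  ring

lemma IsCenteredGaussian.integral_quadratic {p : ℕ} {μ : Measure (Fin p → ℝ)} [IsFiniteMeasure μ]
    {S : Matrix (Fin p) (Fin p) ℝ} (hμ : IsCenteredGaussian μ S) (hS : S.PosSemidef)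
    (M : Matrix (Fin p) (Fin p) ℝ) :
    Integrable (fun x => x ⬝ᵥ M *ᵥ x) μ ∧ ∫ x, x ⬝ᵥ M *ᵥ x ∂μ = (M * S).trace := by
  have he : (fun x : Fin p → ℝ => x ⬝ᵥ M *ᵥ x) = fun x => ∑ i, ∑ j, M i j * (x j * x i) := by
    funext x
    simp only [dotProduct, mulVec, Finset.mul_sum]
    exact Finset.sum_congr rfl fun i _ => Finset.sum_congr rfl fun j _ => by ring
  have hi (i j : Fin p) : Integrable (fun x : Fin p → ℝ => M i j * (x j * x i)) μ :=
    (hμ.integral_mul hS j i).1.const_mul _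
  rw [he]
  refine ⟨integrable_finsetSum _ fun i _ => integrable_finsetSum _ fun j _ => hi i j, ?_⟩
  rw [integral_finsetSum _ fun i _ => integrable_finsetSum _ fun j _ => hi i j]
  simp only [trace, diag, mul_apply]
  refine Finset.sum_congr rfl fun i _ => ?_
  rw [integral_finsetSum _ fun j _ => hi i j]
  exact Finset.sum_congr rfl fun j _ => by
    rw [integral_const_mul, (hμ.integral_mul hS j i).2]

/-- The density of the centred Gaussian law with covariance `S`. -/
def centeredGaussianPDF {p : ℕ} (S : Matrix (Fin p) (Fin p) ℝ) (x : Fin p → ℝ) : ℝ :=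
  (√(2 * Real.pi) ^ p)⁻¹ * Real.exp (-(Real.log S.det + x ⬝ᵥ S⁻¹ *ᵥ x) / 2)

lemma measurable_quadratic {p : ℕ} (M : Matrix (Fin p) (Fin p) ℝ) :
    Measurable fun x : Fin p → ℝ => x ⬝ᵥ M *ᵥ x := by
  simp only [dotProduct, mulVec]; fun_prop

lemma measurable_centeredGaussianPDF {p : ℕ} (S : Matrix (Fin p) (Fin p) ℝ) :
    Measurable (centeredGaussianPDF S) := by
  have := measurable_quadratic S⁻¹
  unfold centeredGaussianPDF
  fun_prop

lemma map_mulVec_withDensity {p : ℕ} {A : Matrix (Fin p) (Fin p) ℝ} (hA : A.det ≠ 0)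
    {f : (Fin p → ℝ) → ENNReal} (hf : Measurable f) :
    (volume.withDensity f).map (A *ᵥ ·) =
      volume.withDensity fun x => ENNReal.ofReal |(A.det)⁻¹| * f (A⁻¹ *ᵥ x) := by
  have hA' : Measurable (A *ᵥ · : (Fin p → ℝ) → _) := by fun_prop
  have hfA : Measurable fun x => f (A⁻¹ *ᵥ x) := by fun_prop
  have hmap : Measure.map (A *ᵥ ·) volume = ENNReal.ofReal |(A.det)⁻¹| • volume :=
    Real.map_matrix_volume_pi_eq_smul_volume_pi hA
  ext s hs
  rw [Measure.map_apply hA' hs, withDensity_apply _ (hA' hs), withDensity_apply _ hs,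
    lintegral_const_mul _ hfA, ← smul_eq_mul, ← lintegral_smul_measure,
    ← Measure.restrict_smul, ← hmap, setLIntegral_map hs hfA hA']
  simp [mulVec_mulVec, nonsing_inv_mul _ (Ne.isUnit hA)]

lemma pi_gaussianReal_eq_withDensity (p : ℕ) :
    (Measure.pi fun _ : Fin p => gaussianReal 0 1) = volume.withDensity fun x =>
      ENNReal.ofReal ((√(2 * Real.pi) ^ p)⁻¹ * Real.exp (-(x ⬝ᵥ x) / 2)) := by
  have h : gaussianReal 0 1 = volume.withDensity (gaussianPDF 0 1) :=
    gaussianReal_of_var_ne_zero 0 one_ne_zero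
  have : SigmaFinite (volume.withDensity (gaussianPDF 0 1)) := by rw [← h]; infer_instance
  rw [h, Measure.pi_withDensity _ _ fun _ => measurable_gaussianPDF 0 1]
  congr 1
  funext x
  simp only [gaussianPDF, gaussianPDFReal]
  rw [← ENNReal.ofReal_prod_of_nonneg fun i _ => by positivity, Finset.prod_mul_distrib,
    ← Real.exp_sum]
  congr 2
  · simp [mul_pow, mul_comm]
  · simp [dotProduct, ← Finset.sum_div, pow_two]

/-- With S = A Aᵀ, uniqueness of characteristic functions identifies μ with the image of the
standard Gaussian under A. The change of variables contributes 1/|det A| = exp(−(log det S)/2). -/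
theorem IsCenteredGaussian.eq_withDensity {p : ℕ} {μ : Measure (Fin p → ℝ)} [IsFiniteMeasure μ]
    {S : Matrix (Fin p) (Fin p) ℝ} (hμ : IsCenteredGaussian μ S) (hS : S.PosDef) :
    μ = volume.withDensity fun x => ENNReal.ofReal (centeredGaussianPDF S x) := by
  obtain ⟨A, hA, rfl⟩ := hS.exists_mul_transpose
  have : Measurable fun x : Fin p → ℝ => x ⬝ᵥ x := by simp only [dotProduct]; fun_prop
  rw [hμ.unique (.map_mulVec A), pi_gaussianReal_eq_withDensity, map_mulVec_withDensity hA
    (by fun_prop)]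
  congr 1
  funext x
  have hq : x ⬝ᵥ (A * Aᵀ)⁻¹ *ᵥ x = (A⁻¹ *ᵥ x) ⬝ᵥ (A⁻¹ *ᵥ x) := by
    rw [Matrix.mul_inv_rev, ← mulVec_mulVec, dotProduct_mulVec, ← transpose_nonsing_inv,
      vecMul_transpose]
  rw [← ENNReal.ofReal_mul (abs_nonneg _), centeredGaussianPDF, hq, det_mul, det_transpose,
    Real.log_mul hA hA, ← Real.log_abs, neg_add, add_div, Real.exp_add,
    show -(Real.log |A.det| + Real.log |A.det|) / 2 = -Real.log |A.det| by ring,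
    Real.exp_neg (Real.log _), Real.exp_log (abs_pos.2 hA), abs_inv]
  congr 1
  ring

/-- The log-likelihood ratio of the centred Gaussian laws with covariances `S` and `T`. -/
def gaussianLogRatio {p : ℕ} (S T : Matrix (Fin p) (Fin p) ℝ) (x : Fin p → ℝ) : ℝ :=
  (Real.log T.det - Real.log S.det + (x ⬝ᵥ T⁻¹ *ᵥ x - x ⬝ᵥ S⁻¹ *ᵥ x)) / 2

lemma measurable_gaussianLogRatio {p : ℕ} (S T : Matrix (Fin p) (Fin p) ℝ) :
    Measurable (gaussianLogRatio S T) := by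
  have := measurable_quadratic S⁻¹
  have := measurable_quadratic T⁻¹
  unfold gaussianLogRatio
  fun_prop

theorem IsCenteredGaussian.eq_withDensity_logRatio {p : ℕ} {μ ν : Measure (Fin p → ℝ)}
    [IsFiniteMeasure μ] [IsFiniteMeasure ν] {S T : Matrix (Fin p) (Fin p) ℝ}
    (hμ : IsCenteredGaussian μ S) (hS : S.PosDef) (hν : IsCenteredGaussian ν T) (hT : T.PosDef) :
    μ = ν.withDensity fun x => ENNReal.ofReal (Real.exp (gaussianLogRatio S T x)) := by
  have hm : Measurable fun x => ENNReal.ofReal (Real.exp (gaussianLogRatio S T x)) := by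
    have := measurable_gaussianLogRatio S T
    fun_prop
  rw [hν.eq_withDensity hT, ← withDensity_mul _
    (measurable_centeredGaussianPDF T).ennreal_ofReal hm, hμ.eq_withDensity hS]
  congr 1
  funext x
  rw [Pi.mul_apply, ← ENNReal.ofReal_mul (by unfold centeredGaussianPDF; positivity),
    centeredGaussianPDF, centeredGaussianPDF, mul_assoc, ← Real.exp_add, gaussianLogRatio]
  congr 3
  ring

/-- The Kullback–Leibler divergence of centred Gaussian laws. -/
theorem IsCenteredGaussian.integral_logRatio {p : ℕ} {μ : Measure (Fin p → ℝ)}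
    [IsProbabilityMeasure μ] {S : Matrix (Fin p) (Fin p) ℝ}
    (hμ : IsCenteredGaussian μ S) (hS : S.PosDef) (T : Matrix (Fin p) (Fin p) ℝ) :
    Integrable (gaussianLogRatio S T) μ ∧ ∫ x, gaussianLogRatio S T x ∂μ =
      (Real.log T.det - Real.log S.det + ((T⁻¹ * S).trace - p)) / 2 := by
  obtain ⟨h1, h1'⟩ := hμ.integral_quadratic hS.posSemidef T⁻¹
  obtain ⟨h2, h2'⟩ := hμ.integral_quadratic hS.posSemidef S⁻¹
  rw [nonsing_inv_mul _ hS.det_pos.ne'.isUnit, trace_one, Fintype.card_fin] at h2'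
  have h12 : Integrable (fun x => x ⬝ᵥ T⁻¹ *ᵥ x - x ⬝ᵥ S⁻¹ *ᵥ x) μ := h1.sub h2
  refine ⟨((integrable_const _).add h12).div_const 2, ?_⟩
  simp only [gaussianLogRatio]
  rw [integral_div, integral_add (integrable_const _) h12, integral_sub h1 h2, h1', h2']
  simp

/-! ### Equicorrelation matrices -/

/-- The equicorrelation matrix with `d + c` on the diagonal and `c` off the diagonal. -/
def equiCov (p : ℕ) (d c : ℝ) : Matrix (Fin p) (Fin p) ℝ := d • 1 + c • vecMulVec 1 1

lemma posDef_equiCov {p : ℕ} {d c : ℝ} (hd : 0 < d) (hc : 0 ≤ c) : (equiCov p d c).PosDef := by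
  refine (PosDef.one.smul hd).add_posSemidef (PosSemidef.smul ?_ hc)
  simpa using posSemidef_vecMulVec_self_star (1 : Fin p → ℝ)

lemma det_equiCov {p : ℕ} {d c : ℝ} (hd : d ≠ 0) :
    (equiCov p d c).det = d ^ p * (1 + p * (c / d)) := by
  have h : equiCov p d c = d • (1 + replicateCol Unit (fun _ : Fin p => c / d) *
      replicateRow Unit (1 : Fin p → ℝ)) := by
    rw [equiCov, ← vecMulVec_eq, smul_add]
    congr 1
    ext i j
    simp
    field_simp
  rw [h, det_smul, det_one_add_replicateCol_mul_replicateRow, Fintype.card_fin]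
  simp [dotProduct]

lemma vecMulVec_one_mul_self (p : ℕ) :
    (vecMulVec 1 1 : Matrix (Fin p) (Fin p) ℝ) * vecMulVec 1 1 = (p : ℝ) • vecMulVec 1 1 := by
  ext i j
  simp [mul_apply]

lemma inv_equiCov {p : ℕ} {d c : ℝ} (hd : 0 < d) (hc : 0 ≤ c) :
    (equiCov p d c)⁻¹ = equiCov p d⁻¹ (-(c / (d * (d + p * c)))) := by
  refine inv_eq_right_inv ?_
  have : d + p * c ≠ 0 := by positivity
  -- The Sherman–Morrison coefficient, chosen so that the all-ones part of the product vanishes.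
  set e := -(c / (d * (d + p * c))) with he
  have h : d * e + c * d⁻¹ + c * e * p = 0 := by
    rw [he]
    field_simp
    ring
  calc equiCov p d c * equiCov p d⁻¹ e
      = (d * d⁻¹) • 1 + (d * e + c * d⁻¹ + c * e * p) • vecMulVec 1 1 := by
        simp only [equiCov, add_mul, mul_add, Matrix.smul_mul, Matrix.mul_smul, smul_smul, one_mul,
          mul_one, vecMulVec_one_mul_self, add_smul]
        rw [mul_comm d⁻¹ d, mul_comm e d, mul_comm d⁻¹ c,
          show e * (c * p) = c * e * p by ring]
        abel
    _ = 1 := by rw [h, mul_inv_cancel₀ hd.ne', one_smul, zero_smul, add_zero]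

lemma trace_equiCov_mul {p : ℕ} (d c : ℝ) (S : Matrix (Fin p) (Fin p) ℝ) :
    (equiCov p d c * S).trace = d * S.trace + c * ∑ i, ∑ j, S i j := by
  rw [equiCov, add_mul, trace_add, smul_mul, smul_mul, one_mul, trace_smul, trace_smul]
  simp only [smul_eq_mul]
  congr 2
  simp only [trace, diag, mul_apply, vecMulVec_apply, Pi.one_apply, one_mul]
  exact Finset.sum_comm

/-! ### Covariance of the model -/

namespace NGLF

variable {p m : ℕ}

/-- The incidence matrix between observed variables and their parents. -/
def incidence (θ : EqualPartition p m) : Matrix (Fin p) (Factor θ) ℝ :=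
  Matrix.of fun i B => if parent θ i = B then 1 else 0

/-- The covariance matrix of the observed variables. -/
def covMatrix (θ : EqualPartition p m) (b a : ℝ) : Matrix (Fin p) (Fin p) ℝ :=
  a • 1 + b • (incidence θ * (incidence θ)ᵀ)

lemma posDef_covMatrix (θ : EqualPartition p m) {b a : ℝ} (hb : 0 ≤ b) (ha : 0 < a) :
    (covMatrix θ b a).PosDef := by
  refine (PosDef.one.smul ha).add_posSemidef (PosSemidef.smul ?_ hb)
  have := posSemidef_self_mul_conjTranspose (incidence θ)
  rwa [conjTranspose_eq_transpose_of_trivial] at this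

lemma parent_eq_iff (θ : EqualPartition p m) (i : Fin p) (B : Factor θ) :
    parent θ i = B ↔ i ∈ B.1 := by
  rw [parent, Subtype.ext_iff]
  constructor
  · intro h
    rw [← h]
    exact θ.1.mem_part (Finset.mem_univ i)
  · exact fun h => θ.1.part_eq_of_mem B.2 h

lemma card_factor (θ : EqualPartition p m) : Fintype.card (Factor θ) = m := by
  simp [θ.2.1]

lemma sum_incidence (θ : EqualPartition p m) (B : Factor θ) :
    ∑ i, incidence θ i B = (p / m : ℕ) := by
  simp [incidence, parent_eq_iff, θ.2.2 B.1 B.2]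

lemma transpose_incidence_mul (θ : EqualPartition p m) :
    (incidence θ)ᵀ * incidence θ = ((p / m : ℕ) : ℝ) • 1 := by
  ext B B'
  rw [mul_apply, Matrix.smul_apply, one_apply]
  by_cases h : B = B'
  · subst h
    rw [if_pos rfl, smul_eq_mul, mul_one, ← sum_incidence θ B]
    refine Finset.sum_congr rfl fun i _ => ?_
    simp only [transpose_apply, incidence, of_apply]
    split_ifs <;> simp
  · rw [if_neg h, smul_zero]
    refine Finset.sum_eq_zero fun i _ => ?_
    simp only [transpose_apply, incidence, of_apply]
    by_cases h' : parent θ i = B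
    · rw [if_neg fun h2 => h (h'.symm.trans h2), mul_zero]
    · rw [if_neg h', zero_mul]

/-- Sylvester's identity det(1 + UV) = det(1 + VU) passes to an m × m matrix, which is scalar
because the groups are disjoint and of equal size. -/
lemma det_covMatrix (θ : EqualPartition p m) {b a : ℝ} (ha : a ≠ 0) :
    (covMatrix θ b a).det = a ^ p * (1 + b / a * (p / m : ℕ)) ^ m := by
  have h : covMatrix θ b a = a • (1 + incidence θ * ((b / a) • (incidence θ)ᵀ)) := by
    rw [covMatrix, Matrix.mul_smul, smul_add, smul_smul, mul_div_cancel₀ _ ha]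
  have h2 : (1 : Matrix (Factor θ) (Factor θ) ℝ) + (b / a) • (((p / m : ℕ) : ℝ) • 1) =
      (1 + b / a * (p / m : ℕ)) • 1 := by
    rw [smul_smul, add_smul, one_smul]
  rw [h, det_smul, det_one_add_mul_comm, Matrix.smul_mul, transpose_incidence_mul, h2, det_smul,
    det_one, mul_one, Fintype.card_fin, card_factor]

lemma trace_covMatrix (hm : m ≠ 0) (hdvd : m ∣ p) (θ : EqualPartition p m) (b a : ℝ) :
    (covMatrix θ b a).trace = p * (a + b) := by
  rw [covMatrix, trace_add, trace_smul, trace_smul, trace_one, trace_mul_comm,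
    transpose_incidence_mul, trace_smul, trace_one, card_factor, Fintype.card_fin]
  obtain ⟨k, rfl⟩ := hdvd
  rw [Nat.mul_div_cancel_left _ (Nat.pos_of_ne_zero hm)]
  push_cast
  simp only [smul_eq_mul]
  ring

lemma sum_covMatrix (θ : EqualPartition p m) (b a : ℝ) :
    ∑ i, ∑ j, covMatrix θ b a i j = p * (a + b * (p / m : ℕ)) := by
  have h (i : Fin p) : ∑ j, covMatrix θ b a i j = a + b * (p / m : ℕ) := by
    simp only [covMatrix, Matrix.add_apply, Matrix.smul_apply, smul_eq_mul, Finset.sum_add_distrib,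
      ← Finset.mul_sum]
    congr 1
    · simp [one_apply]
    · congr 1
      simp only [mul_apply, transpose_apply]
      rw [Finset.sum_comm]
      simp only [← Finset.mul_sum, sum_incidence, ← Finset.sum_mul]
      simp [incidence]
  simp only [h, Finset.sum_const, Finset.card_univ, Fintype.card_fin, nsmul_eq_mul]

lemma isCenteredGaussian_observedLaw (θ : EqualPartition p m) (b a : ℝ≥0) :
    IsCenteredGaussian (observedLaw θ b a) (covMatrix θ b a) := by
  intro w
  have hobs : Measurable (observe θ) := by
    unfold observe; fun_prop
  have hw (ω : (Factor θ → ℝ) × (Fin p → ℝ)) :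
      w ⬝ᵥ observe θ ω = ((incidence θ)ᵀ *ᵥ w) ⬝ᵥ ω.1 + w ⬝ᵥ ω.2 := by
    have : observe θ ω = incidence θ *ᵥ ω.1 + ω.2 := by
      funext i
      simp [observe, incidence, mulVec, dotProduct]
    rw [this, dotProduct_add, dotProduct_mulVec, mulVec_transpose]
  rw [observedLaw, sourceLaw, integral_map hobs.aemeasurable
    (Measurable.aestronglyMeasurable (by simp only [dotProduct]; fun_prop))]
  simp_rw [hw, Complex.ofReal_add, add_mul, Complex.exp_add]
  rw [integral_prod_mul (fun z : Factor θ → ℝ =>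
      Complex.exp ((((incidence θ)ᵀ *ᵥ w) ⬝ᵥ z : ℝ) * Complex.I))
    (fun y : Fin p → ℝ => Complex.exp ((w ⬝ᵥ y : ℝ) * Complex.I)),
    integral_exp_dotProduct_pi_gaussianReal, integral_exp_dotProduct_pi_gaussianReal,
    ← Complex.exp_add]
  have : w ⬝ᵥ covMatrix θ b a *ᵥ w =
      b * (((incidence θ)ᵀ *ᵥ w) ⬝ᵥ ((incidence θ)ᵀ *ᵥ w)) + a * (w ⬝ᵥ w) := by
    rw [covMatrix, add_mulVec, dotProduct_add, smul_mulVec, smul_mulVec, dotProduct_smul,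
      dotProduct_smul, one_mulVec, ← mulVec_mulVec, dotProduct_mulVec w, ← mulVec_transpose]
    simp only [smul_eq_mul]
    ring
  rw [this]
  congr 1
  push_cast
  ring

end NGLF

/-! ### Sample laws and their divergence from the reference -/

namespace NGLF

variable {p m : ℕ}

instance (θ : EqualPartition p m) (b a : ℝ≥0) : IsProbabilityMeasure (observedLaw θ b a) := by
  have hobs : Measurable (observe θ) := by
    unfold observe; fun_prop
  unfold observedLaw sourceLaw
  exact Measure.isProbabilityMeasure_map hobs.aemeasurable

instance (n : ℕ) (θ : EqualPartition p m) (b a : ℝ≥0) :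
    IsProbabilityMeasure (sampleLaw n θ b a) := by
  unfold sampleLaw
  infer_instance

theorem sampleLaw_eq_withDensity (n : ℕ) (θ : EqualPartition p m) {b a : ℝ≥0} (ha : 0 < a)
    {ν : Measure (Fin p → ℝ)} [IsProbabilityMeasure ν] {T : Matrix (Fin p) (Fin p) ℝ}
    (hν : IsCenteredGaussian ν T) (hT : T.PosDef) :
    sampleLaw n θ b a = (Measure.pi fun _ : Fin n => ν).withDensity fun x =>
      ENNReal.ofReal (Real.exp (∑ j, gaussianLogRatio (covMatrix θ b a) T (x j))) := by
  have h := (isCenteredGaussian_observedLaw θ b a).eq_withDensity_logRatio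
    (posDef_covMatrix θ b.2 ha) hν hT
  have hm := measurable_gaussianLogRatio (covMatrix θ b a) T
  have : SigmaFinite (ν.withDensity fun x =>
      ENNReal.ofReal (Real.exp (gaussianLogRatio (covMatrix θ b a) T x))) := by
    rw [← h]; infer_instance
  rw [sampleLaw, h, Measure.pi_withDensity _ _ fun _ => by fun_prop]
  congr 1
  funext x
  rw [← ENNReal.ofReal_prod_of_nonneg fun _ _ => (Real.exp_pos _).le, Real.exp_sum]

theorem integral_sampleLaw_sum (n : ℕ) (θ : EqualPartition p m) (b a : ℝ≥0)
    {f : (Fin p → ℝ) → ℝ} (hf : Integrable f (observedLaw θ b a)) :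
    Integrable (fun x => ∑ j : Fin n, f (x j)) (sampleLaw n θ b a) ∧
      ∫ x, ∑ j : Fin n, f (x j) ∂(sampleLaw n θ b a) = n * ∫ x, f x ∂(observedLaw θ b a) := by
  have hi (j : Fin n) : Integrable (fun x : Fin n → Fin p → ℝ => f (x j)) (sampleLaw n θ b a) :=
    integrable_comp_eval (i := j) hf
  refine ⟨integrable_finsetSum _ fun j _ => hi j, ?_⟩
  rw [integral_finsetSum _ fun j _ => hi j]
  have (j : Fin n) : ∫ x, f (x j) ∂(sampleLaw n θ b a) = ∫ x, f x ∂(observedLaw θ b a) :=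
    integral_comp_eval (i := j) hf.aestronglyMeasurable
  simp [this]

/-- The covariance between distinct variables, averaged over all structures. -/
def meanCov (p m : ℕ) (b : ℝ) : ℝ := b * ((p : ℝ) / m - 1) / (p - 1)

lemma meanCov_nonneg {b : ℝ} (hm : 1 < m) (hmp : m < p) (hb : 0 < b) : 0 ≤ meanCov p m b := by
  have h1 : (1 : ℝ) < m := by exact_mod_cast hm
  have h2 : (m : ℝ) < p := by exact_mod_cast hmp
  have : 1 ≤ (p : ℝ) / m := by rw [one_le_div (by linarith)]; exact h2.le
  exact div_nonneg (mul_nonneg hb.le (by linarith)) (by linarith)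

lemma add_sub_meanCov {a b : ℝ} (hm : 1 < m) (hmp : m < p) (ha : 0 < a) :
    a + b - meanCov p m b =
      a * (1 + b / a * ((1 - 1 / (m : ℝ)) / (1 - 1 / (p : ℝ)))) := by
  have h1 : (1 : ℝ) < m := by exact_mod_cast hm
  have h2 : (m : ℝ) < p := by exact_mod_cast hmp
  have h3 : (p : ℝ) - 1 ≠ 0 := by linarith
  have h4 : (p : ℝ) ≠ 0 := by linarith
  have : 1 - 1 / (p : ℝ) ≠ 0 := by rw [one_sub_div h4]; exact div_ne_zero h3 h4
  rw [meanCov]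
  field_simp
  ring

lemma snr_factor_pos {s : ℝ} (hm : 1 < m) (hmp : m < p) (hs : 0 < s) :
    0 < 1 + s * ((1 - 1 / (m : ℝ)) / (1 - 1 / (p : ℝ))) := by
  have h1 : (1 : ℝ) < m := by exact_mod_cast hm
  have h2 : (m : ℝ) < p := by exact_mod_cast hmp
  have h3 : 0 ≤ 1 - 1 / (m : ℝ) := by
    rw [one_sub_div (by linarith)]; exact div_nonneg (by linarith) (by linarith)
  have h4 : 0 ≤ 1 - 1 / (p : ℝ) := by
    rw [one_sub_div (by linarith)]; exact div_nonneg (by linarith) (by linarith)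
  positivity

theorem integral_logRatio_observedLaw (hm : 1 < m) (hmp : m < p) (hdvd : m ∣ p)
    (θ : EqualPartition p m) {b a : ℝ≥0} (hb : 0 < b) (ha : 0 < a) {s : ℝ}
    (hs : s = (b : ℝ) / (a : ℝ)) :
    let l := gaussianLogRatio (covMatrix θ b a)
      (equiCov p (a + b - meanCov p m b) (meanCov p m b))
    Integrable l (observedLaw θ b a) ∧ ∫ x, l x ∂(observedLaw θ b a) =
      (((p : ℝ) - 1) * Real.log (1 + s * ((1 - 1 / (m : ℝ)) / (1 - 1 / (p : ℝ))))
        - ((m : ℝ) - 1) * Real.log (1 + s * ((p : ℝ) / (m : ℝ)))) / 2 := by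
  intro l
  have hb' : (0 : ℝ) < b := hb
  have ha' : (0 : ℝ) < a := ha
  have h1 : (1 : ℝ) < m := by exact_mod_cast hm
  have h2 : (m : ℝ) < p := by exact_mod_cast hmp
  have hs0 : 0 < s := by rw [hs]; positivity
  have hsn := snr_factor_pos hm hmp hs0
  obtain ⟨hl, hl'⟩ := (isCenteredGaussian_observedLaw θ b a).integral_logRatio
    (posDef_covMatrix θ hb'.le ha') (equiCov p (a + b - meanCov p m b) (meanCov p m b))
  refine ⟨hl, hl'.trans ?_⟩
  have hd := add_sub_meanCov (b := b) hm hmp ha'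
  rw [← hs] at hd
  have hc := meanCov_nonneg (b := b) hm hmp hb'
  have hdpos : 0 < a + b - meanCov p m b := by rw [hd]; exact mul_pos ha' hsn
  -- The eigenvalue on the all-ones vector, common to the reference covariance and to every model
  -- covariance.
  have hdc : (a + b - meanCov p m b) + p * meanCov p m b = a * (1 + s * (p / m)) := by
    have h3 : (p : ℝ) - 1 ≠ 0 := by linarith
    rw [meanCov, hs]
    field_simp
    ring
  have hr : 0 < 1 + s * ((p : ℝ) / m) := by positivity
  have hk : ((p / m : ℕ) : ℝ) = (p : ℝ) / m := Nat.cast_div hdvd (by linarith)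
  -- Pairing with the inverse of an equicorrelation matrix sees only the trace and the sum of
  -- entries, and in these the model agrees with the reference.
  have htr : ((equiCov p (a + b - meanCov p m b) (meanCov p m b))⁻¹ * covMatrix θ b a).trace
      = p := by
    rw [inv_equiCov hdpos hc, trace_equiCov_mul, trace_covMatrix (by omega) hdvd, sum_covMatrix,
      hdc, hk]
    have e : (a : ℝ) + b * (p / m) = a * (1 + s * (p / m)) := by rw [hs]; field_simp
    rw [e]
    field_simp
    ring
  have hdet : Real.log (equiCov p (a + b - meanCov p m b) (meanCov p m b)).det =
      (p - 1) * Real.log (a + b - meanCov p m b) + Real.log a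
        + Real.log (1 + s * (p / m)) := by
    have e : 1 + p * (meanCov p m b / (a + b - meanCov p m b)) =
        a * (1 + s * (p / m)) / (a + b - meanCov p m b) := by
      rw [← hdc]
      field_simp
    rw [det_equiCov hdpos.ne', e, Real.log_mul (by positivity) (by positivity), Real.log_pow,
      Real.log_div (by positivity) hdpos.ne', Real.log_mul ha'.ne' hr.ne']
    ring
  rw [htr, hdet, det_covMatrix θ ha'.ne', ← hs, hk, Real.log_mul (by positivity) (by positivity),
    Real.log_pow, Real.log_pow, hd, Real.log_mul ha'.ne' hsn.ne']
  ring

lemma sum_accuracy {n : ℕ} (K : Kernel (Fin n → Fin p → ℝ) (EqualPartition p m))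
    [IsMarkovKernel K] [Nonempty (EqualPartition p m)] (b a : ℝ≥0) :
    ∑ θ, ((sampleLaw n θ b a).bind K).real {θ} =
      Fintype.card (EqualPartition p m) * (1 - avgErrorProb K b a) := by
  have hN : (Fintype.card (EqualPartition p m) : ℝ) ≠ 0 := by
    exact_mod_cast Fintype.card_ne_zero
  have h (θ : EqualPartition p m) : ((sampleLaw n θ b a).bind K).real {θ} =
      1 - errorProb K b a θ := by
    rw [errorProb, probReal_compl_eq_one_sub (measurableSet_singleton θ)]
    ring
  rw [avgErrorProb, mul_sub, mul_div_cancel₀ _ hN]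
  simp [h]

end NGLF

/-! ### The lower bound on the sample size -/

theorem theorem1 (p m n : ℕ) (hm : 1 < m) (hmp : m < p) (hdvd : m ∣ p)
    (b a : NNReal) (hb : 0 < b) (ha : 0 < a) (s : ℝ) (hs : s = (b : ℝ) / (a : ℝ))
    (K : ProbabilityTheory.Kernel (Fin n → Fin p → ℝ) (EqualPartition p m))
    (hK : ProbabilityTheory.IsMarkovKernel K)
    (ε : ℝ) (hε : NGLF.avgErrorProb K b a ≤ ε)
    (β : ℝ) (hβ : 2 ≤ β) :
    0 < ((p : ℝ) - 1) * Real.logb β (1 + s * ((1 - 1 / (m : ℝ)) / (1 - 1 / (p : ℝ))))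
          - ((m : ℝ) - 1) * Real.logb β (1 + s * ((p : ℝ) / (m : ℝ))) ∧
      (n : ℝ) ≥
        2 * ((1 - ε) * Real.logb β (NGLF.numStructures p m) - 1) /
          (((p : ℝ) - 1) * Real.logb β (1 + s * ((1 - 1 / (m : ℝ)) / (1 - 1 / (p : ℝ))))
            - ((m : ℝ) - 1) * Real.logb β (1 + s * ((p : ℝ) / (m : ℝ)))) := by
  have hb' : (0 : ℝ) < b := hb
  have ha' : (0 : ℝ) < a := ha
  have hs0 : 0 < s := by rw [hs]; positivity
  have hlog2 : Real.log 2 ≤ Real.log β := Real.log_le_log two_pos hβ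
  have hlogβ : 0 < Real.log β := (Real.log_pos one_lt_two).trans_le hlog2
  have hgap := sub_pos.2 (log_weighted_lt (p := p) (m := m) (by exact_mod_cast hm)
    (by exact_mod_cast hmp) hs0)
  set D := ((p : ℝ) - 1) * Real.log (1 + s * ((1 - 1 / (m : ℝ)) / (1 - 1 / (p : ℝ))))
    - ((m : ℝ) - 1) * Real.log (1 + s * ((p : ℝ) / (m : ℝ))) with hD
  have hDβ : ((p : ℝ) - 1) * Real.logb β (1 + s * ((1 - 1 / (m : ℝ)) / (1 - 1 / (p : ℝ))))
      - ((m : ℝ) - 1) * Real.logb β (1 + s * ((p : ℝ) / (m : ℝ))) = D / Real.log β := by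
    simp only [Real.logb, hD]
    ring
  rw [hDβ]
  refine ⟨div_pos hgap hlogβ, ?_⟩
  have hns := NGLF.one_le_numStructures (p := p) (m := m) (by omega) (by omega) hdvd
  have hcard := NGLF.numStructures_le_card (p := p) (m := m) (by omega) (by omega) hdvd
  have hN1 := hns.trans hcard
  have : Nonempty (EqualPartition p m) := by
    rw [← Fintype.card_pos_iff]
    exact_mod_cast zero_lt_one.trans_le hN1
  have hdpos : 0 < a + b - NGLF.meanCov p m b := by
    rw [NGLF.add_sub_meanCov hm hmp ha', ← hs]
    exact mul_pos ha' (NGLF.snr_factor_pos hm hmp hs0)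
  have hT := posDef_equiCov (p := p) hdpos (NGLF.meanCov_nonneg hm hmp hb')
  -- The reference law is realized as a linear image of the standard Gaussian.
  obtain ⟨A, -, hA⟩ := hT.exists_mul_transpose
  have hν := IsCenteredGaussian.map_mulVec A
  rw [← hA] at hν
  have : IsProbabilityMeasure ((Measure.pi fun _ : Fin p => gaussianReal 0 1).map (A *ᵥ ·)) :=
    Measure.isProbabilityMeasure_map (by fun_prop)
  have hint (θ : EqualPartition p m) :=
    NGLF.integral_logRatio_observedLaw hm hmp hdvd θ hb ha hs
  have hsum (θ : EqualPartition p m) := NGLF.integral_sampleLaw_sum n θ b a (hint θ).1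
  have hfano := fano_of_withDensity _ (fun θ => NGLF.sampleLaw n θ b a) _
    (fun θ => Finset.measurable_sum _ fun j _ =>
      (measurable_gaussianLogRatio _ _).comp (measurable_pi_apply j))
    (fun θ => NGLF.sampleLaw_eq_withDensity n θ ha hν hT) K (n * (D / 2))
    (fun θ => (hsum θ).1) (fun θ => ((hsum θ).2.trans (by rw [(hint θ).2])).le)
  rw [NGLF.sum_accuracy, mul_assoc, mul_le_mul_iff_right₀ (by linarith)] at hfano
  -- There is no upper bound on ε, so passing from `numStructures` to the true cardinality is done
  -- with the actual error probability, for which 1 − error is nonnegative.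
  have herr : NGLF.avgErrorProb K b a ≤ 1 := by
    have h0 : 0 ≤ ∑ θ, ((NGLF.sampleLaw n θ b a).bind K).real {θ} :=
      Finset.sum_nonneg fun θ _ => measureReal_nonneg
    rw [NGLF.sum_accuracy] at h0
    linarith [nonneg_of_mul_nonneg_right h0 (by linarith)]
  have hlogns : 0 ≤ Real.log (NGLF.numStructures p m) := Real.log_nonneg hns
  have hlogle := Real.log_le_log (by linarith) hcard
  have h1 : (1 - ε) * Real.log (NGLF.numStructures p m) ≤ n * (D / 2) + Real.log 2 :=
    calc _ ≤ (1 - NGLF.avgErrorProb K b a) * Real.log (NGLF.numStructures p m) :=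
          mul_le_mul_of_nonneg_right (by linarith) hlogns
      _ ≤ _ := (mul_le_mul_of_nonneg_left hlogle (by linarith)).trans hfano
  rw [ge_iff_le, div_le_iff₀ (div_pos hgap hlogβ), Real.logb, ← mul_div_assoc,
    ← mul_div_assoc, div_sub_one hlogβ.ne', ← mul_div_assoc, div_le_div_iff_of_pos_right hlogβ]
  -- Fano's additive log 2 becomes the 1 in the claim through log 2 ≤ log β; this is where β ≥ 2 is
  -- needed.
  linarith

end
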